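/- Let $S^1=\mathbb{R}/\mathbb{Z}$ be the circle of length one, and for $t>0$ and $f\in L^1(S^1)$ let $$[e^{t\Delta}f](x)=\sum_{k\in\mathbb{Z}}e^{-4\pi^2k^2t}\,\widehat f(k)\,e^{2\pi i k x},\qquad \widehat f(k)=\int_{S^1}f(y)e^{-2\pi i k y}\,dy,$$ be the solution at time $t$ of the heat equation on $S^1$ with initial datum $f$. For every $t>0$ there is $N(t)\in\mathbb{N}$, depending only on $t$, such that for all $n\ge N(t)$ the following holds: points $x_1,\dots,x_n\in S^1$ minimize, among all choices of $n$ points of $S^1$, the worst-case sampling error $$\sup_{0\ne f\in L^1(S^1)}\frac{1}{\|f\|_{L^1}}\left|\frac1n\sum_{k=1}^n[e^{t\Delta}f](x_k)-\int_{S^1}f(x)\,dx\right|$$ if and only if they are equispaced, that is, up to relabelling, $x_k=z+\frac{k-1}{n} \pmod 1$ for $k=1,\dots,n$ and some $z\in S^1$. -/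

import Mathlib

noncomputable section

open MeasureTheory AddCircle

namespace HeatSampling

/-- The heat semigroup `e^{tΔ}`, with `Δ = d²/dx²` on the circle `S¹ = ℝ/ℤ` of length one, as a
Fourier multiplier: the character `e^{2πikx}` is an eigenfunction of `Δ` with eigenvalue
`-4π²k²`. For `t > 0` and integrable `f` the series converges absolutely (see
`summable_heatFlow`) and gives the smooth representative of `e^{tΔ}f`, so that point values make
sense. -/
def heatFlow (t : ℝ) (f : UnitAddCircle → ℂ) (x : UnitAddCircle) : ℂ :=
  ∑' k : ℤ, (Real.exp (-(4 * Real.pi ^ 2 * (k : ℝ) ^ 2 * t)) : ℂ) * fourierCoeff f k * fourier k x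

/-- The error made when `∫ f` is estimated by averaging `e^{tΔ}f` over the points `x₁, …, xₙ`.
`haarAddCircle` is the length measure of `ℝ/ℤ`, of total mass one. -/
def samplingError {n : ℕ} (t : ℝ) (x : Fin n → UnitAddCircle) (f : UnitAddCircle → ℂ) : ℝ :=
  ‖(1 / (n : ℂ)) * (∑ k, heatFlow t f (x k)) - ∫ y, f y ∂haarAddCircle‖

/-- The worst case of the sampling error, relative to the `L¹` norm, over all nonzero
`f ∈ L¹(S¹)`. The supremum is taken in `[0, ∞]`. -/
def worstCaseError {n : ℕ} (t : ℝ) (x : Fin n → UnitAddCircle) : ENNReal :=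
  ⨆ (f : Lp ℂ 1 (haarAddCircle (T := (1 : ℝ)))) (_ : f ≠ 0),
    ENNReal.ofReal (samplingError t x f / ‖f‖)

/-- The points `x₁, …, xₙ` are equispaced on the circle: up to relabelling they are
`z, z + 1/n, …, z + (n-1)/n` for some `z`. -/
def Equispaced {n : ℕ} (x : Fin n → UnitAddCircle) : Prop :=
  ∃ (z : UnitAddCircle) (σ : Equiv.Perm (Fin n)),
    ∀ k : Fin n, x (σ k) = z + (((k : ℝ) / (n : ℝ) : ℝ) : UnitAddCircle)

theorem summable_heatFlow {t : ℝ} (ht : 0 < t) (f : UnitAddCircle → ℂ) (x : UnitAddCircle) :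
    Summable fun k : ℤ =>
      (Real.exp (-(4 * Real.pi ^ 2 * (k : ℝ) ^ 2 * t)) : ℂ) * fourierCoeff f k * fourier k x := by
  have hg : Summable fun k : ℤ => Real.exp (-(4 * Real.pi ^ 2 * (k : ℝ) ^ 2 * t)) := by
    have h := (summable_jacobiTheta₂_term_iff 0 (Complex.I * ((4 * Real.pi * t : ℝ) : ℂ))).2
      (by simp; positivity)
    refine h.norm.congr fun k => ?_
    rw [norm_jacobiTheta₂_term]
    congr 1
    simp
    ring
  refine Summable.of_norm_bounded (hg.mul_right (∫ y, ‖f y‖ ∂haarAddCircle)) fun k => ?_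
  have hb : ‖fourierCoeff f k‖ ≤ ∫ y, ‖f y‖ ∂haarAddCircle := by
    refine (norm_integral_le_integral_norm _).trans (le_of_eq ?_)
    refine integral_congr_ae (Filter.Eventually.of_forall fun y => ?_)
    change ‖(fourier (-k) y : ℂ) * f y‖ = ‖f y‖
    rw [norm_mul, fourier_apply, Circle.norm_coe, one_mul]
  have h1 : ‖(Real.exp (-(4 * Real.pi ^ 2 * (k : ℝ) ^ 2 * t)) : ℂ)‖
      = Real.exp (-(4 * Real.pi ^ 2 * (k : ℝ) ^ 2 * t)) := by
    rw [Complex.norm_real, Real.norm_of_nonneg (Real.exp_pos _).le]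
  have h2 : ‖(fourier k x : ℂ)‖ = 1 := by rw [fourier_apply, Circle.norm_coe]
  rw [norm_mul, norm_mul, h1, h2, mul_one]
  exact mul_le_mul_of_nonneg_left hb (Real.exp_pos _).le

end HeatSampling

end

/-!
By duality the worst-case error of `x` is the sup norm of `(1/n) ∑ⱼ K(xⱼ - ·) - 1`, where `K` is
the heat kernel, a theta series with coefficients `q ^ (k ^ 2)`. For equispaced points this norm is
attained as a maximum, `combMax q n - 1`, so a minimizer satisfies `∑ⱼ K(xⱼ - y) ≤ n * combMax q n`
for all `y`.

A function bounded by `B` with mean `M` has all its nonconstant Fourier coefficients bounded by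
`B - M`. Hence every exponential sum `∑ⱼ e(k xⱼ)` with `1 ≤ k ≤ n / 2` is small, and Newton's
identities then show that all the phases `e(n xⱼ)` are close to each other, within `2 n ε` if `ε`
is the largest modulus of these sums. Let `ε` be attained at `k = r`. Averaging the upper bound
over the translates by `l / n` with the mean-zero weights `e(-r l / n)` keeps only the frequencies
congruent to `0` and to `r` modulo `n`. The former lose only a second order term from their
maximum, because the phases `e(n xⱼ)` nearly agree, and the latter are dominated by
`q ^ (r ^ 2) * ∑ⱼ e(r xⱼ)`; so `ε` is at most a small multiple of itself and vanishes. If `n = 2r`,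
then `r ≡ -r` and only `Re ∑ⱼ e(r (xⱼ - z))` is controlled, but to second order, which leaves room
to choose `z` so that this real part is at least of order `ε ^ 2`. Once all the sums vanish,
Newton's identities say that `e(x₁), …, e(xₙ)` are the roots of `X ^ n - w` for some `w` of modulus
one.
-/

noncomputable section

open MeasureTheory AddCircle Finset

namespace HeatSampling

section PowerSums

open MvPolynomial

variable {𝕜 ι : Type*} [RCLike 𝕜] [Fintype ι] {z : ι → 𝕜} {ε : ℝ}

theorem norm_aeval_esymm_le_of_norm_sum_pow_le (hε : ε ≤ 1) {K : ℕ}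
    (hp : ∀ k, 1 ≤ k → k ≤ K → ‖∑ i, z i ^ k‖ ≤ ε) (k : ℕ) (hk : 1 ≤ k) (hkK : k ≤ K) :
    ‖aeval z (esymm ι 𝕜 k)‖ ≤ ε := by
  induction k using Nat.strong_induction_on with
  | _ k ih =>
  have hle_one (i : ℕ) (hi : i < k) : ‖aeval z (esymm ι 𝕜 i)‖ ≤ 1 := by
    rcases Nat.eq_zero_or_pos i with rfl | hi0
    · simp
    · exact (ih i hi hi0 (by lia)).trans hε
  have hcard : #{a ∈ antidiagonal k | a.1 < k} = k := by
    rw [card_filter, Nat.sum_antidiagonal_eq_sum_range_succ_mk, sum_range_succ,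
      sum_congr rfl fun i hi => if_pos (mem_range.1 hi)]
    simp
  have newton := congrArg (fun p => ‖aeval z p‖) (mul_esymm_eq_sum ι 𝕜 k)
  simp only [map_mul, map_sum, map_pow, map_neg, map_one, map_natCast, psum, aeval_X, norm_mul,
    norm_pow, norm_neg, norm_one, one_pow, one_mul, RCLike.norm_natCast] at newton
  refine le_of_mul_le_mul_left ?_ (Nat.cast_pos.2 hk : (0 : ℝ) < k)
  calc k * ‖aeval z (esymm ι 𝕜 k)‖
      ≤ ∑ a ∈ antidiagonal k with a.1 < k,
          ‖(-1) ^ a.1 * aeval z (esymm ι 𝕜 a.1) * ∑ i, z i ^ a.2‖ := newton ▸ norm_sum_le _ _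
    _ ≤ ∑ a ∈ antidiagonal k with a.1 < k, 1 * ε := by
      refine sum_le_sum fun a ha => ?_
      obtain ⟨ha, hlt⟩ := mem_filter.1 ha
      have hsum := mem_antidiagonal.1 ha
      rw [norm_mul, norm_mul, norm_pow, norm_neg, norm_one, one_pow, one_mul]
      exact mul_le_mul (hle_one _ hlt) (hp _ (by lia) (by lia)) (norm_nonneg _) zero_le_one
    _ = k * ε := by rw [sum_const, hcard, one_mul, nsmul_eq_mul]

theorem norm_aeval_esymm_card_sub (hz : ∀ i, ‖z i‖ = 1) {k : ℕ} (hk : k ≤ Fintype.card ι) :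
    ‖aeval z (esymm ι 𝕜 (Fintype.card ι - k))‖ = ‖aeval z (esymm ι 𝕜 k)‖ := by
  classical
  have hinv (i : ι) : z i * starRingEnd 𝕜 (z i) = 1 := by simp [RCLike.mul_conj, hz]
  have hreflect : aeval z (esymm ι 𝕜 (Fintype.card ι - k)) =
      (∏ i, z i) * starRingEnd 𝕜 (aeval z (esymm ι 𝕜 k)) := by
    simp only [esymm, map_sum, map_prod, aeval_X, mul_sum]
    refine sum_nbij' compl compl ?_ ?_ (fun s _ => compl_compl s) (fun s _ => compl_compl s) ?_
    · intro s hs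
      rw [mem_powersetCard_univ] at hs ⊢
      rw [card_compl]
      lia
    · intro s hs
      rw [mem_powersetCard_univ] at hs ⊢
      rw [card_compl]
      lia
    · intro s _
      rw [← prod_mul_prod_compl s z, mul_assoc, ← prod_mul_distrib,
        prod_congr rfl fun i _ => hinv i, prod_const_one, mul_one]
  simp [hreflect, norm_prod, hz]

theorem prod_sub_eq_sum_aeval_esymm (z : ι → 𝕜) (X : 𝕜) :
    ∏ i, (X - z i) = ∑ k ∈ range (Fintype.card ι + 1),
      (-1) ^ k * aeval z (esymm ι 𝕜 k) * X ^ (Fintype.card ι - k) := by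
  have h := congrArg (Polynomial.eval X) (Multiset.prod_X_sub_X_eq_sum_esymm (univ.val.map z))
  simp only [Multiset.map_map, Multiset.card_map, card_val, card_univ, Polynomial.eval_finsetSum,
    Polynomial.eval_multiset_prod, Function.comp_def, Polynomial.eval_sub, Polynomial.eval_mul,
    Polynomial.eval_pow, Polynomial.eval_neg, Polynomial.eval_one, Polynomial.eval_C,
    Polynomial.eval_X, ← aeval_esymm_eq_multiset_esymm ι 𝕜] at h
  simpa only [Finset.prod, mul_assoc] using h

/- Newton's identities bound the elementary symmetric functions of degree at most `n / 2`, and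
`‖e_{n-k}‖ = ‖e_k‖` for points of modulus one bounds the others. -/
theorem exists_norm_prod_sub_le [Nonempty ι] (hz : ∀ i, ‖z i‖ = 1) (hε : ε ≤ 1)
    (hp : ∀ k, 1 ≤ k → 2 * k ≤ Fintype.card ι → ‖∑ i, z i ^ k‖ ≤ ε) :
    ∃ w : 𝕜, ∀ X : 𝕜, ‖∏ i, (X - z i) - (X ^ Fintype.card ι - w)‖ ≤
      ∑ k ∈ range (Fintype.card ι - 1), ε * ‖X‖ ^ (Fintype.card ι - (k + 1)) := by
  obtain ⟨m, hm⟩ := Nat.exists_eq_succ_of_ne_zero (Fintype.card_ne_zero (α := ι))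
  have hesymm (k : ℕ) (hk : 1 ≤ k) (hkm : k ≤ m) : ‖aeval z (esymm ι 𝕜 k)‖ ≤ ε := by
    have hlow := norm_aeval_esymm_le_of_norm_sum_pow_le (K := Fintype.card ι / 2) hε
      fun k h1 h2 => hp k h1 (by lia)
    rcases le_or_gt k (Fintype.card ι / 2) with h | h
    · exact hlow k hk h
    · rw [← norm_aeval_esymm_card_sub hz (by lia)]
      exact hlow _ (by lia) (by lia)
  refine ⟨-((-1) ^ (m + 1) * aeval z (esymm ι 𝕜 (m + 1))), fun X => ?_⟩
  have hdiff : ∏ i, (X - z i) - (X ^ (m + 1) - -((-1) ^ (m + 1) * aeval z (esymm ι 𝕜 (m + 1))))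
      = ∑ k ∈ range m, (-1) ^ (k + 1) * aeval z (esymm ι 𝕜 (k + 1)) * X ^ (m + 1 - (k + 1)) := by
    rw [prod_sub_eq_sum_aeval_esymm, hm, sum_range_succ, sum_range_succ', esymm_zero]
    simp
  rw [hm, hdiff, Nat.succ_sub_one]
  refine norm_sum_le_of_le _ fun k hk => ?_
  have hk := mem_range.1 hk
  rw [norm_mul, norm_mul, norm_pow, norm_pow, norm_neg, norm_one, one_pow, one_mul]
  exact mul_le_mul_of_nonneg_right (hesymm _ (by lia) (by lia)) (by positivity)

theorem norm_pow_card_sub_pow_card_le (hz : ∀ i, ‖z i‖ = 1) (hε : ε ≤ 1)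
    (hp : ∀ k, 1 ≤ k → 2 * k ≤ Fintype.card ι → ‖∑ i, z i ^ k‖ ≤ ε) (i j : ι) :
    ‖z i ^ Fintype.card ι - z j ^ Fintype.card ι‖ ≤ 2 * (Fintype.card ι - 1 : ℕ) * ε := by
  have : Nonempty ι := ⟨i⟩
  obtain ⟨w, hw⟩ := exists_norm_prod_sub_le hz hε hp
  have hroot (i : ι) : ‖z i ^ Fintype.card ι - w‖ ≤ (Fintype.card ι - 1 : ℕ) * ε := by
    have hprod : ∏ j, (z i - z j) = 0 := prod_eq_zero (mem_univ i) (sub_self _)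
    simpa only [hprod, zero_sub, norm_neg, hz, one_pow, mul_one, sum_const, card_range,
      nsmul_eq_mul] using hw (z i)
  have htriangle := norm_sub_le (z i ^ Fintype.card ι - w) (z j ^ Fintype.card ι - w)
  rw [sub_sub_sub_cancel_right] at htriangle
  linarith [hroot i, hroot j]

theorem injective_of_sum_pow_eq_zero (hz : ∀ i, ‖z i‖ = 1)
    (hp : ∀ k, 1 ≤ k → 2 * k ≤ Fintype.card ι → ∑ i, z i ^ k = 0) : Function.Injective z := by
  rcases isEmpty_or_nonempty ι with _ | ⟨⟨i⟩⟩
  · exact Function.injective_of_subsingleton z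
  have : Nonempty ι := ⟨i⟩
  obtain ⟨w, hw⟩ := exists_norm_prod_sub_le hz zero_le_one
    fun k h1 h2 => (norm_eq_zero.2 (hp k h1 h2)).le
  have hprod (X : 𝕜) : ∏ i, (X - z i) = X ^ Fintype.card ι - w := by
    simpa only [zero_mul, sum_const_zero, norm_le_zero_iff, sub_eq_zero] using hw X
  have hpoly : ∏ i, (Polynomial.X - Polynomial.C (z i)) =
      Polynomial.X ^ Fintype.card ι - Polynomial.C w :=
    Polynomial.funext fun X => by simpa [Polynomial.eval_prod] using hprod X
  have hw0 : w ≠ 0 := by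
    have hpow : z i ^ Fintype.card ι = w :=
      sub_eq_zero.1 (hprod (z i) ▸ prod_eq_zero (mem_univ i) (sub_self _))
    rw [← norm_ne_zero_iff, ← hpow, norm_pow, hz, one_pow]
    exact one_ne_zero
  rw [← Polynomial.separable_prod_X_sub_C_iff, hpoly]
  exact Polynomial.separable_X_pow_sub_C w (by simp) hw0

end PowerSums

section UnitComplex

theorem norm_zpow_sub_one_le {𝕜 : Type*} [NormedDivisionRing 𝕜] {u : 𝕜} (hu : ‖u‖ = 1) (m : ℤ) :
    ‖u ^ m - 1‖ ≤ |(m : ℝ)| * ‖u - 1‖ := by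
  have hnat (k : ℕ) : ‖u ^ k - 1‖ ≤ k * ‖u - 1‖ := by
    rw [← geom_sum_mul, norm_mul]
    gcongr
    refine (norm_sum_le _ _).trans_eq ?_
    simp only [norm_pow, hu, one_pow, sum_const, card_range, nsmul_eq_mul, mul_one]
  rcases Int.eq_nat_or_neg m with ⟨k, rfl | rfl⟩
  · simpa using hnat k
  · have hu0 : u ^ k ≠ 0 := pow_ne_zero k (norm_ne_zero_iff.1 (hu ▸ one_ne_zero))
    have hneg : u ^ (-(k : ℤ)) - 1 = -((u ^ k)⁻¹ * (u ^ k - 1)) := by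
      rw [zpow_neg, zpow_natCast, mul_sub, inv_mul_cancel₀ hu0, mul_one, neg_sub]
    rw [hneg, norm_neg, norm_mul, norm_inv, norm_pow, hu, one_pow, inv_one, one_mul]
    simpa using hnat k

variable {v : ℂ}

theorem re_eq_one_sub_norm_sub_one_sq_div_two (hv : ‖v‖ = 1) : v.re = 1 - ‖v - 1‖ ^ 2 / 2 := by
  rw [Complex.sq_norm, Complex.normSq_sub, ← Complex.sq_norm, hv, map_one, map_one, mul_one]
  ring

theorem abs_re_zpow_sub_one_le (hv : ‖v‖ = 1) (m : ℤ) :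
    |(v ^ m).re - 1| ≤ (m : ℝ) ^ 2 * (‖v - 1‖ ^ 2 / 2) := by
  rw [re_eq_one_sub_norm_sub_one_sq_div_two (by rw [norm_zpow, hv, one_zpow]), sub_sub_cancel_left,
    abs_neg, abs_of_nonneg (by positivity), ← mul_div_assoc, ← sq_abs (m : ℝ), ← mul_pow]
  gcongr
  exact norm_zpow_sub_one_le hv m

theorem two_mul_re_zpow (hv : ‖v‖ = 1) (k : ℤ) : ((2 * (v ^ k).re : ℝ) : ℂ) = v ^ k + v ^ (-k) := by
  rw [← Complex.add_conj, zpow_neg, Complex.inv_eq_conj (by rw [norm_zpow, hv, one_zpow])]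

-- `2 (Re v^{2m+1} - Re v) = v^{-(2m+1)} (v^{2m} - 1) (v^{2m+2} - 1)` has two small factors.
theorem abs_re_zpow_sub_re_le (hv : ‖v‖ = 1) (m : ℤ) :
    |(v ^ (2 * m + 1)).re - v.re| ≤ |(m : ℝ) * (m + 1)| * (‖v ^ 2 - 1‖ ^ 2 / 2) := by
  have hv0 : v ≠ 0 := norm_ne_zero_iff.1 (hv ▸ one_ne_zero)
  have hv2 : ‖v ^ 2‖ = 1 := by rw [norm_pow, hv, one_pow]
  have hfactor : ((2 * ((v ^ (2 * m + 1)).re - v.re) : ℝ) : ℂ) =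
      v ^ (-(2 * m + 1)) * ((v ^ 2) ^ m - 1) * ((v ^ 2) ^ (m + 1) - 1) := by
    have hone := two_mul_re_zpow hv 1
    rw [zpow_one] at hone
    rw [mul_sub, Complex.ofReal_sub, two_mul_re_zpow hv, hone]
    have hm : v ^ m ≠ 0 := zpow_ne_zero _ hv0
    simp only [zpow_add₀ hv0, zpow_neg, zpow_one, two_mul, pow_two, mul_zpow]
    field_simp
    ring
  have hnorm := congrArg norm hfactor
  rw [Complex.norm_real, Real.norm_eq_abs, abs_mul, abs_two, norm_mul, norm_mul, norm_zpow, hv,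
    one_zpow, one_mul] at hnorm
  have hmul := mul_le_mul (norm_zpow_sub_one_le hv2 m) (norm_zpow_sub_one_le hv2 (m + 1))
    (norm_nonneg _) (by positivity)
  push_cast at hmul
  rw [abs_mul]
  linarith

theorem exists_norm_mul_sin_le_abs_re (P : ℂ) {α : ℝ} (h0 : 0 ≤ Real.sin α)
    (hsc : Real.sin α ≤ Real.cos α) :
    ∃ β : ℝ, |β| = |α| ∧ ‖P‖ * Real.sin α ≤ |(P * Complex.exp (β * Complex.I)).re| := by
  have hre (β : ℝ) : (P * Complex.exp (β * Complex.I)).re =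
      P.re * Real.cos β - P.im * Real.sin β := by
    rw [Complex.mul_re, Complex.exp_ofReal_mul_I_re, Complex.exp_ofReal_mul_I_im]
  have hsum : ‖P‖ * Real.sin α ≤ |P.re * Real.cos α| + |P.im * Real.sin α| := by
    rw [abs_mul, abs_mul, abs_of_nonneg h0, abs_of_nonneg (h0.trans hsc)]
    calc ‖P‖ * Real.sin α ≤ (|P.re| + |P.im|) * Real.sin α := by
          gcongr
          exact Complex.norm_le_abs_re_add_abs_im P
      _ ≤ _ := by
          rw [add_mul]
          gcongr
  rcases le_total 0 (P.re * Real.cos α * (P.im * Real.sin α)) with hab | hab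
  · refine ⟨-α, abs_neg α, hsum.trans_eq ?_⟩
    rw [hre, Real.cos_neg, Real.sin_neg, mul_neg, sub_neg_eq_add]
    exact (abs_add_eq_add_abs_iff _ _).2 (mul_nonneg_iff.1 hab) |>.symm
  · refine ⟨α, rfl, hsum.trans_eq ?_⟩
    rw [hre, ← abs_neg (P.im * Real.sin α), sub_eq_add_neg]
    refine (abs_add_eq_add_abs_iff _ _).2 (mul_nonneg_iff.1 ?_) |>.symm
    linarith

end UnitComplex

section MeanZeroWeights

theorem integral_add_norm_integral_mul_le {X : Type*} [MeasurableSpace X] {μ : Measure X}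
    [IsFiniteMeasure μ] {S : X → ℝ} {w : X → ℂ} {B : ℝ} (hSi : Integrable S μ)
    (hwi : Integrable w μ) (hS : ∀ᵐ u ∂μ, S u ≤ B) (hw : ∀ᵐ u ∂μ, ‖w u‖ ≤ 1)
    (hw0 : ∫ u, w u ∂μ = 0) :
    ∫ u, S u ∂μ + ‖∫ u, w u * S u ∂μ‖ ≤ μ.real Set.univ * B := by
  have hcancel : ∫ u, w u * ((B - S u : ℝ) : ℂ) ∂μ = -∫ u, w u * S u ∂μ := by
    have hwS : Integrable (fun u => w u * S u) μ :=
      hSi.ofReal.bdd_mul hwi.aestronglyMeasurable hw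
    simp only [Complex.ofReal_sub, mul_sub]
    rw [integral_sub (hwi.mul_const _) hwS, integral_mul_const, hw0, zero_mul, zero_sub]
  have hle : ‖∫ u, w u * ((B - S u : ℝ) : ℂ) ∂μ‖ ≤ ∫ u, (B - S u) ∂μ := by
    refine norm_integral_le_of_norm_le ((integrable_const B).sub hSi) ?_
    filter_upwards [hS, hw] with u hSu hwu
    rw [norm_mul, Complex.norm_real, Real.norm_of_nonneg (sub_nonneg.2 hSu)]
    exact mul_le_of_le_one_left (sub_nonneg.2 hSu) hwu
  rw [hcancel, norm_neg, integral_sub (integrable_const B) hSi, integral_const, smul_eq_mul] at hle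
  linarith

theorem sum_add_norm_sum_mul_le {ι : Type*} {s : Finset ι} {S : ι → ℝ} {w : ι → ℂ} {B : ℝ}
    (hS : ∀ i ∈ s, S i ≤ B) (hw : ∀ i ∈ s, ‖w i‖ ≤ 1) (hw0 : ∑ i ∈ s, w i = 0) :
    ∑ i ∈ s, S i + ‖∑ i ∈ s, w i * S i‖ ≤ #s * B := by
  let _ : MeasurableSpace s := ⊤
  have hle := integral_add_norm_integral_mul_le (μ := Measure.count) (S := fun i : s => S i)
    (w := fun i : s => w i) .of_finite .of_finite (.of_forall fun i => hS i i.2)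
    (.of_forall fun i => hw i i.2) (by rwa [integral_count, sum_coe_sort s w])
  rw [integral_count, integral_count, sum_coe_sort s S, sum_coe_sort s fun i => w i * S i] at hle
  simpa using hle

end MeanZeroWeights

section WeightedSums

theorem norm_tsum_smul_sub_le {E ι : Type*} [NormedAddCommGroup E] [NormedSpace ℝ E]
    [CompleteSpace E] {c b : ι → ℝ} {f : ι → E} {a : E} {δ : ℝ} (hc : ∀ i, 0 ≤ c i)
    (hcs : Summable c) (hbs : Summable fun i => b i * c i) (hf : ∀ i, ‖f i - a‖ ≤ b i * δ) :
    ‖∑' i, c i • f i - (∑' i, c i) • a‖ ≤ (∑' i, b i * c i) * δ := by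
  have hle (i : ι) : ‖c i • (f i - a)‖ ≤ b i * c i * δ := by
    rw [norm_smul, Real.norm_of_nonneg (hc i), mul_comm (b i), mul_assoc]
    exact mul_le_mul_of_nonneg_left (hf i) (hc i)
  have hdiff : Summable fun i => c i • (f i - a) := (hbs.mul_right δ).of_norm_bounded hle
  have hsum : ∑' i, c i • f i = ∑' i, c i • (f i - a) + (∑' i, c i) • a := by
    rw [← hcs.tsum_smul_const, ← hdiff.tsum_add (hcs.smul_const a)]
    exact tsum_congr fun i => by rw [smul_sub, sub_add_cancel]
  rw [hsum, add_sub_cancel_right]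
  exact tsum_of_norm_bounded (hbs.hasSum.mul_right δ) hle

variable {q : ℝ}

theorem summable_pow_mul_pow_natAbs (hq : ‖q‖ < 1) (i : ℕ) :
    Summable fun m : ℤ => (m : ℝ) ^ i * q ^ m.natAbs := by
  have hgeom := summable_pow_mul_geometric_of_norm_lt_one i hq
  refine .of_nat_of_neg (by simpa using hgeom) ?_
  refine (hgeom.mul_left ((-1) ^ i)).congr fun m => ?_
  rw [Int.natAbs_neg, Int.natAbs_natCast, Int.cast_neg, Int.cast_natCast, neg_pow (m : ℝ),
    mul_assoc]

theorem summable_zpow_sq (h0 : 0 < q) (h1 : q < 1) : Summable fun k : ℤ => q ^ (k ^ 2) := by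
  have hgeom := summable_pow_mul_pow_natAbs (by rwa [Real.norm_of_nonneg h0.le]) 0
  refine hgeom.of_nonneg_of_le (fun k => zpow_nonneg h0.le _) fun k => ?_
  rw [pow_zero, one_mul, ← zpow_natCast]
  exact zpow_le_zpow_right_of_le_one₀ h0 h1.le (Int.natAbs_le_self_sq k)

/-- If `g m ^ 2` exceeds `r ^ 2` by at least `n * |m|` for every `m`, then the series of
`q ^ (g m ^ 2)`, even with factors `m ^ 2`, is at most `q ^ (r ^ 2) * tailBound q n`; see
`tsum_mul_zpow_sq_le`. -/
def tailBound (q : ℝ) (n : ℕ) : ℝ := q ^ n * (q⁻¹ * ∑' m : ℤ, (m : ℝ) ^ 2 * q ^ m.natAbs)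

theorem tailBound_nonneg (h0 : 0 ≤ q) (n : ℕ) : 0 ≤ tailBound q n :=
  mul_nonneg (by positivity) (mul_nonneg (inv_nonneg.2 h0) (tsum_nonneg fun _ => by positivity))

variable {B : ℝ} {b : ℤ → ℝ} {g : ℤ → ℤ} {r : ℤ} {n : ℕ}

theorem mul_zpow_sq_le (h0 : 0 < q) (h1 : q < 1) (hn : n ≠ 0) {c : ℝ} {k m : ℤ} (hc : 0 ≤ c)
    (hcB : c ≤ B * (m : ℝ) ^ 2) (hk : c ≠ 0 → r ^ 2 + n * |m| ≤ k ^ 2) :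
    c * q ^ (k ^ 2) ≤ B * (q ^ (r ^ 2) * q ^ n * q⁻¹) * ((m : ℝ) ^ 2 * q ^ m.natAbs) := by
  rcases hc.eq_or_lt with rfl | hc
  · have : 0 ≤ B * (m : ℝ) ^ 2 * (q ^ (r ^ 2) * q ^ n * q⁻¹ * q ^ m.natAbs) :=
      mul_nonneg hcB (by positivity)
    linarith
  have hm : m ≠ 0 := by
    rintro rfl
    simp at hcB
    linarith
  have hexp : r ^ 2 + n + -1 + m.natAbs ≤ k ^ 2 := by
    have hn1 : (1 : ℤ) ≤ n := by lia
    nlinarith [hk hc.ne', Int.one_le_abs hm, Int.natCast_natAbs m]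
  have hpow : q ^ (k ^ 2) ≤ q ^ (r ^ 2) * q ^ n * q⁻¹ * q ^ m.natAbs := by
    rw [← zpow_natCast, ← zpow_natCast, ← zpow_neg_one q, ← zpow_add₀ h0.ne', ← zpow_add₀ h0.ne',
      ← zpow_add₀ h0.ne']
    exact zpow_le_zpow_right_of_le_one₀ h0 h1.le hexp
  calc c * q ^ (k ^ 2)
      ≤ B * (m : ℝ) ^ 2 * (q ^ (r ^ 2) * q ^ n * q⁻¹ * q ^ m.natAbs) :=
        mul_le_mul hcB hpow (zpow_nonneg h0.le _) (hc.le.trans hcB)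
    _ = _ := by ring

theorem summable_mul_zpow_sq (h0 : 0 < q) (h1 : q < 1) (hn : n ≠ 0) (hb : ∀ m, 0 ≤ b m)
    (hbB : ∀ m, b m ≤ B * (m : ℝ) ^ 2) (hg : ∀ m, b m ≠ 0 → r ^ 2 + n * |m| ≤ g m ^ 2) :
    Summable fun m => b m * q ^ (g m ^ 2) :=
  ((summable_pow_mul_pow_natAbs (by rwa [Real.norm_of_nonneg h0.le]) 2).mul_left _).of_nonneg_of_le
    (fun m => mul_nonneg (hb m) (zpow_nonneg h0.le _))
    fun m => mul_zpow_sq_le h0 h1 hn (hb m) (hbB m) (hg m)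

theorem tsum_mul_zpow_sq_le (h0 : 0 < q) (h1 : q < 1) (hn : n ≠ 0) (hb : ∀ m, 0 ≤ b m)
    (hbB : ∀ m, b m ≤ B * (m : ℝ) ^ 2) (hg : ∀ m, b m ≠ 0 → r ^ 2 + n * |m| ≤ g m ^ 2) :
    ∑' m, b m * q ^ (g m ^ 2) ≤ B * (q ^ (r ^ 2) * tailBound q n) := by
  have hmajorant := (summable_pow_mul_pow_natAbs (by rwa [Real.norm_of_nonneg h0.le]) 2).mul_left
    (B * (q ^ (r ^ 2) * q ^ n * q⁻¹))
  calc ∑' m, b m * q ^ (g m ^ 2)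
      ≤ ∑' m : ℤ, B * (q ^ (r ^ 2) * q ^ n * q⁻¹) * ((m : ℝ) ^ 2 * q ^ m.natAbs) :=
        (summable_mul_zpow_sq h0 h1 hn hb hbB hg).tsum_le_tsum
          (fun m => mul_zpow_sq_le h0 h1 hn (hb m) (hbB m) (hg m)) hmajorant
    _ = _ := by
        rw [tsum_mul_left, tailBound]
        ring

theorem norm_tsum_zpow_sq_smul_sub_le {E : Type*} [NormedAddCommGroup E] [NormedSpace ℝ E]
    [CompleteSpace E] {f : ℤ → E} {a : E} {δ : ℝ} (h0 : 0 < q) (h1 : q < 1) (hn : n ≠ 0)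
    (hb : ∀ m, 0 ≤ b m) (hbB : ∀ m, b m ≤ B * (m : ℝ) ^ 2)
    (hg : ∀ m, b m ≠ 0 → r ^ 2 + n * |m| ≤ g m ^ 2) (hgs : Summable fun m => q ^ (g m ^ 2))
    (hδ : 0 ≤ δ) (hf : ∀ m, ‖f m - a‖ ≤ b m * δ) :
    ‖∑' m, q ^ (g m ^ 2) • f m - (∑' m, q ^ (g m ^ 2)) • a‖ ≤
      B * (q ^ (r ^ 2) * tailBound q n) * δ :=
  (norm_tsum_smul_sub_le (fun _ => zpow_nonneg h0.le _) hgs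
    (summable_mul_zpow_sq h0 h1 hn hb hbB hg) hf).trans
      (mul_le_mul_of_nonneg_right (tsum_mul_zpow_sq_le h0 h1 hn hb hbB hg) hδ)

end WeightedSums

section Fourier

theorem norm_fourier_apply {T : ℝ} (k : ℤ) (x : AddCircle T) : ‖(fourier k x : ℂ)‖ = 1 :=
  Circle.norm_coe _

theorem fourier_apply_add {T : ℝ} (k : ℤ) (x y : AddCircle T) :
    (fourier k (x + y) : ℂ) = fourier k x * fourier k y := by
  rw [fourier_apply, smul_add, toCircle_add, Circle.coe_mul, fourier_apply, fourier_apply]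

theorem fourier_apply_sub {T : ℝ} (k : ℤ) (x y : AddCircle T) :
    (fourier k (x - y) : ℂ) = fourier k x * fourier (-k) y := by
  rw [fourier_apply, smul_sub, sub_eq_add_neg, ← neg_smul, toCircle_add, Circle.coe_mul,
    fourier_apply, fourier_apply]

theorem sum_fourier_sub {T : ℝ} {ι : Type*} (s : Finset ι) (k : ℤ) (x : ι → AddCircle T)
    (z : AddCircle T) :
    ∑ j ∈ s, (fourier k (x j - z) : ℂ) = (∑ j ∈ s, (fourier k (x j) : ℂ)) * fourier (-k) z := by
  simp only [fourier_apply_sub, sum_mul]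

theorem fourier_apply_nsmul {T : ℝ} (k : ℤ) (l : ℕ) (x : AddCircle T) :
    (fourier k (l • x) : ℂ) = (fourier k x : ℂ) ^ l := by
  rw [fourier_apply, fourier_apply, smul_comm, toCircle_nsmul, Circle.coe_pow]

theorem fourier_mul_apply {T : ℝ} (k m : ℤ) (x : AddCircle T) :
    (fourier (k * m) x : ℂ) = (fourier k x : ℂ) ^ m := by
  rw [fourier_apply, fourier_apply, mul_comm, mul_smul, toCircle_zsmul, Circle.coe_zpow]

theorem fourier_natCast_apply {T : ℝ} (k : ℕ) (x : AddCircle T) :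
    (fourier (k : ℤ) x : ℂ) = (fourier 1 x : ℂ) ^ k := by
  rw [← zpow_natCast, ← fourier_mul_apply, one_mul]

theorem summable_mul_fourier {T : ℝ} {a : ℤ → ℂ} (ha : Summable a) (x : AddCircle T) :
    Summable fun k => a k * fourier k x :=
  ha.norm.of_norm_bounded fun k => by rw [norm_mul, norm_fourier_apply, mul_one]

variable {n : ℕ}

theorem coe_natCast_div_eq_nsmul (l : ℕ) :
    (((l : ℝ) / n : ℝ) : UnitAddCircle) = l • ((1 / n : ℝ) : UnitAddCircle) := by
  rw [← AddCircle.coe_nsmul, nsmul_eq_mul, mul_one_div]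

theorem fourier_one_div_eq_one_iff (hn : n ≠ 0) (k : ℤ) :
    (fourier k ((1 / n : ℝ) : UnitAddCircle) : ℂ) = 1 ↔ (n : ℤ) ∣ k := by
  have hn0 : (n : ℂ) ≠ 0 := Nat.cast_ne_zero.2 hn
  rw [fourier_coe_apply, Complex.exp_eq_one_iff]
  refine exists_congr fun m => ?_
  push_cast
  rw [← Int.cast_inj (α := ℂ)]
  push_cast
  field_simp

theorem sum_fourier_div (hn : n ≠ 0) (k : ℤ) :
    ∑ l ∈ range n, (fourier k (((l : ℝ) / n : ℝ) : UnitAddCircle) : ℂ) =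
      if (n : ℤ) ∣ k then (n : ℂ) else 0 := by
  simp only [coe_natCast_div_eq_nsmul, fourier_apply_nsmul]
  split_ifs with h
  · simp only [(fourier_one_div_eq_one_iff hn k).2 h, one_pow, sum_const, card_range, nsmul_one]
  · rw [geom_sum_eq (mt (fourier_one_div_eq_one_iff hn k).1 h), ← fourier_apply_nsmul,
      ← coe_natCast_div_eq_nsmul, div_self (Nat.cast_ne_zero.2 hn : (n : ℝ) ≠ 0),
      AddCircle.coe_period, fourier_eval_zero, sub_self, zero_div]

theorem injective_add_natCast_mul (hn : n ≠ 0) (r : ℤ) :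
    Function.Injective fun m : ℤ => r + n * m :=
  (add_right_injective r).comp (mul_right_injective₀ (Nat.cast_ne_zero.2 hn))

theorem sum_fourier_neg_mul_tsum (hn : n ≠ 0) (r : ℤ) {a : ℤ → ℂ} (ha : Summable a)
    (y : UnitAddCircle) :
    ∑ l ∈ range n, (fourier (-r) (((l : ℝ) / n : ℝ) : UnitAddCircle) : ℂ) *
      ∑' k, a k * fourier k (y + (((l : ℝ) / n : ℝ) : UnitAddCircle)) =
        n * ∑' m : ℤ, a (r + n * m) * fourier (r + n * m) y := by
  have hterm (k : ℤ) : ∑ l ∈ range n, (fourier (-r) (((l : ℝ) / n : ℝ) : UnitAddCircle) : ℂ) *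
      (a k * fourier k (y + (((l : ℝ) / n : ℝ) : UnitAddCircle))) =
        n * if (n : ℤ) ∣ k - r then a k * fourier k y else 0 := by
    rw [mul_ite_zero, mul_comm, ← mul_ite_zero, ← sum_fourier_div hn, mul_sum]
    refine sum_congr rfl fun l _ => ?_
    rw [fourier_apply_add, sub_eq_add_neg, fourier_add]
    ring
  simp only [← tsum_mul_left]
  rw [← Summable.tsum_finsetSum fun l _ => (summable_mul_fourier ha _).mul_left _,
    tsum_congr hterm, ← (injective_add_natCast_mul hn r).tsum_eq]
  · simp
  · intro k hk
    obtain ⟨m, hm⟩ : (n : ℤ) ∣ k - r := by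
      by_contra h
      simp [h] at hk
    exact ⟨m, by lia⟩

end Fourier

section Theta

variable {q : ℝ} {n : ℕ}

/-- The theta series with nome `q` on the circle. For `q = exp (-4π²t)` it is the heat kernel of the
circle at time `t`. -/
def thetaKernel (q : ℝ) (y : UnitAddCircle) : ℝ := ∑' k : ℤ, q ^ (k ^ 2) * (fourier k y : ℂ).re

/-- The part of the theta series `thetaKernel q` carried by the frequencies congruent to `r`
modulo `n`. -/
def thetaComb (q : ℝ) (n : ℕ) (r : ℤ) (y : UnitAddCircle) : ℂ :=
  ∑' m : ℤ, ((q ^ ((r + n * m) ^ 2) : ℝ) : ℂ) * fourier (r + n * m) y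

/-- The largest value of `thetaComb q n 0`, attained at `0`. -/
def combMax (q : ℝ) (n : ℕ) : ℝ := ∑' m : ℤ, q ^ ((n * m : ℤ) ^ 2)

theorem ofReal_thetaKernel (h0 : 0 < q) (h1 : q < 1) (y : UnitAddCircle) :
    (thetaKernel q y : ℂ) = ∑' k : ℤ, ((q ^ (k ^ 2) : ℝ) : ℂ) * fourier k y := by
  have hconj : starRingEnd ℂ (∑' k : ℤ, ((q ^ (k ^ 2) : ℝ) : ℂ) * fourier k y) =
      ∑' k : ℤ, ((q ^ (k ^ 2) : ℝ) : ℂ) * fourier k y := by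
    rw [Complex.conj_tsum, ← (Equiv.neg ℤ).tsum_eq]
    refine tsum_congr fun k => ?_
    rw [Equiv.neg_apply, neg_sq, map_mul, Complex.conj_ofReal, fourier_neg, Complex.conj_conj]
  have hsum := summable_mul_fourier (Complex.summable_ofReal.2 (summable_zpow_sq h0 h1)) y
  rw [← Complex.conj_eq_iff_re.1 hconj, Complex.re_tsum hsum]
  simp only [thetaKernel, Complex.re_ofReal_mul]

theorem sum_fourier_neg_mul_thetaKernel (h0 : 0 < q) (h1 : q < 1) (hn : n ≠ 0) (r : ℤ)
    (y : UnitAddCircle) :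
    ∑ l ∈ range n, (fourier (-r) (((l : ℝ) / n : ℝ) : UnitAddCircle) : ℂ) *
      thetaKernel q (y + (((l : ℝ) / n : ℝ) : UnitAddCircle)) = n * thetaComb q n r y := by
  simp only [ofReal_thetaKernel h0 h1]
  exact sum_fourier_neg_mul_tsum hn r (Complex.summable_ofReal.2 (summable_zpow_sq h0 h1)) y

theorem sum_thetaKernel_add_div (h0 : 0 < q) (h1 : q < 1) (hn : n ≠ 0) (y : UnitAddCircle) :
    ∑ l ∈ range n, thetaKernel q (y + (((l : ℝ) / n : ℝ) : UnitAddCircle)) =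
      n * (thetaComb q n 0 y).re := by
  have h := congrArg Complex.re (sum_fourier_neg_mul_thetaKernel h0 h1 hn 0 y)
  simpa only [neg_zero, fourier_zero, one_mul, Complex.re_sum, Complex.ofReal_re,
    ← nsmul_eq_mul, Complex.re_nsmul] using h

-- The values on the translates of `z` by `l / n` are averaged with weights `e(-rl/n)` of mean zero.
theorem sum_re_thetaComb_add_norm_sum_le (h0 : 0 < q) (h1 : q < 1) (hn : n ≠ 0) {r : ℤ}
    (hr : ¬ (n : ℤ) ∣ r) {ι : Type*} [Fintype ι] {x : ι → UnitAddCircle} {B : ℝ}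
    (hB : ∀ y, ∑ j, thetaKernel q (x j - y) ≤ B) (z : UnitAddCircle) :
    ∑ j, (thetaComb q n 0 (x j - z)).re + ‖∑ j, thetaComb q n r (x j - z)‖ ≤ B := by
  let S (l : ℕ) : ℝ := ∑ j, thetaKernel q (x j - z + (((l : ℝ) / n : ℝ) : UnitAddCircle))
  have hS (l : ℕ) : S l ≤ B := by
    simpa only [S, ← sub_add] using hB (z - (((l : ℝ) / n : ℝ) : UnitAddCircle))
  have hweights : ∑ l ∈ range n, (fourier (-r) (((l : ℝ) / n : ℝ) : UnitAddCircle) : ℂ) = 0 := by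
    rw [sum_fourier_div hn, if_neg (by rwa [dvd_neg])]
  have hmean : ∑ l ∈ range n, S l = n * ∑ j, (thetaComb q n 0 (x j - z)).re := by
    rw [sum_comm, mul_sum]
    exact sum_congr rfl fun j _ => sum_thetaKernel_add_div h0 h1 hn _
  have htwist : ∑ l ∈ range n, (fourier (-r) (((l : ℝ) / n : ℝ) : UnitAddCircle) : ℂ) * S l =
      n * ∑ j, thetaComb q n r (x j - z) := by
    simp only [S, Complex.ofReal_sum, mul_sum]
    rw [sum_comm]
    refine sum_congr rfl fun j _ => sum_fourier_neg_mul_thetaKernel h0 h1 hn r _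
  have hle := sum_add_norm_sum_mul_le (fun l _ => hS l) (fun l _ => (norm_fourier_apply _ _).le)
    hweights
  rw [hmean, htwist, norm_mul, Complex.norm_natCast, card_range, ← mul_add] at hle
  exact le_of_mul_le_mul_left hle (by positivity)

theorem summable_zpow_add_natCast_mul_sq (h0 : 0 < q) (h1 : q < 1) (hn : n ≠ 0) (r : ℤ) :
    Summable fun m : ℤ => q ^ ((r + n * m) ^ 2) :=
  (summable_zpow_sq h0 h1).comp_injective (injective_add_natCast_mul hn r)

theorem zpow_sq_le_tsum (h0 : 0 < q) (h1 : q < 1) (hn : n ≠ 0) (r : ℤ) :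
    q ^ (r ^ 2) ≤ ∑' m : ℤ, q ^ ((r + n * m) ^ 2) := by
  simpa using (summable_zpow_add_natCast_mul_sq h0 h1 hn r).le_tsum 0
    fun m _ => zpow_nonneg h0.le _

theorem re_thetaComb (h0 : 0 < q) (h1 : q < 1) (hn : n ≠ 0) (r : ℤ) (y : UnitAddCircle) :
    (thetaComb q n r y).re = ∑' m : ℤ, q ^ ((r + n * m) ^ 2) * (fourier (r + n * m) y : ℂ).re := by
  have hsum := (summable_mul_fourier (Complex.summable_ofReal.2 (summable_zpow_sq h0 h1))
    y).comp_injective (injective_add_natCast_mul hn r)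
  simpa only [thetaComb, Function.comp_apply, Complex.re_ofReal_mul] using Complex.re_tsum hsum

section Expansion

variable {r : ℕ}

theorem sq_add_mul_abs_le_zero_add_sq (hn : 2 ≤ n) (hr : 2 * r ≤ n) {m : ℤ} (hm : m ≠ 0) :
    (r : ℤ) ^ 2 + n * |m| ≤ (0 + n * m) ^ 2 := by
  have hle : (n : ℤ) ≤ n * |m| := le_mul_of_one_le_right (by positivity) (Int.one_le_abs hm)
  zify at hn hr
  rw [zero_add, ← sq_abs (n * m : ℤ), abs_mul, Nat.abs_cast]
  nlinarith

theorem sq_add_mul_abs_le_add_sq (hr : 2 * r < n) {m : ℤ} (hm : m ≠ 0) :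
    (r : ℤ) ^ 2 + n * |m| ≤ (r + n * m) ^ 2 := by
  suffices h : 0 ≤ n * (m * (2 * r + n * m) - |m|) by linarith
  refine mul_nonneg (by positivity) ?_
  zify at hr
  rcases lt_or_gt_of_ne hm with hm | hm
  · have : 1 ≤ -(2 * r + n * m) := by nlinarith
    rw [abs_of_neg hm]
    nlinarith
  · have : 1 ≤ 2 * r + n * m := by nlinarith
    rw [abs_of_pos hm]
    nlinarith

theorem sq_add_two_mul_mul_abs_le_add_sq (r : ℕ) {m : ℤ} (hm : m * (m + 1) ≠ 0) :
    (r : ℤ) ^ 2 + (2 * r : ℕ) * |m| ≤ (r + (2 * r : ℕ) * m) ^ 2 := by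
  have habs : |m| ≤ m * (m + 1) := by
    obtain ⟨hm0, hm1⟩ := mul_ne_zero_iff.1 hm
    rcases lt_or_gt_of_ne hm0 with hneg | hpos
    · rw [abs_of_neg hneg]
      nlinarith [(by lia : m ≤ -2)]
    · rw [abs_of_pos hpos]
      nlinarith
  have hr : (2 * r : ℤ) ≤ (2 * r) ^ 2 := Int.le_self_sq _
  push_cast
  nlinarith [mul_le_mul hr habs (abs_nonneg m) (by positivity)]

theorem abs_re_thetaComb_zero_sub_combMax_le (h0 : 0 < q) (h1 : q < 1) (hn : 2 ≤ n)
    (hr : 2 * r ≤ n) (y : UnitAddCircle) :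
    |(thetaComb q n 0 y).re - combMax q n| ≤
      q ^ ((r : ℤ) ^ 2) * tailBound q n * (‖(fourier n y : ℂ) - 1‖ ^ 2 / 2) := by
  have hn0 : n ≠ 0 := by lia
  have hexpand := norm_tsum_zpow_sq_smul_sub_le (B := 1) (a := (1 : ℝ))
    (f := fun m : ℤ => (fourier (0 + n * m) y : ℂ).re) h0 h1 hn0 (fun m => sq_nonneg (m : ℝ))
    (fun m => (one_mul _).ge)
    (fun m hm => sq_add_mul_abs_le_zero_add_sq hn hr (by simpa using hm))
    (summable_zpow_add_natCast_mul_sq h0 h1 hn0 0)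
    (by positivity : 0 ≤ ‖(fourier n y : ℂ) - 1‖ ^ 2 / 2) fun m => by
      rw [zero_add, fourier_mul_apply]
      exact abs_re_zpow_sub_one_le (norm_fourier_apply _ _) m
  simpa only [re_thetaComb h0 h1 hn0, combMax, smul_eq_mul, mul_one, one_mul, zero_add,
    Real.norm_eq_abs] using hexpand

theorem abs_intCast_le_sq (m : ℤ) : |(m : ℝ)| ≤ (m : ℝ) ^ 2 := by
  exact_mod_cast (Int.natCast_natAbs m).symm.trans_le (Int.natAbs_le_self_sq m)

theorem norm_thetaComb_sub_le (h0 : 0 < q) (h1 : q < 1) (hr : 2 * r < n) (y : UnitAddCircle) :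
    ‖thetaComb q n r y - (∑' m : ℤ, q ^ ((r + n * m) ^ 2) : ℝ) * fourier r y‖ ≤
      q ^ ((r : ℤ) ^ 2) * tailBound q n * ‖(fourier n y : ℂ) - 1‖ := by
  have hn0 : n ≠ 0 := by lia
  have hexpand := norm_tsum_zpow_sq_smul_sub_le (a := (fourier r y : ℂ))
    (f := fun m : ℤ => (fourier (r + n * m) y : ℂ)) h0 h1 hn0 (fun m => abs_nonneg (m : ℝ))
    (fun m => (abs_intCast_le_sq m).trans_eq (one_mul _).symm)
    (fun m hm => sq_add_mul_abs_le_add_sq hr (by simpa using hm))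
    (summable_zpow_add_natCast_mul_sq h0 h1 hn0 r)
    (norm_nonneg ((fourier n y : ℂ) - 1)) fun m => by
      rw [fourier_add, fourier_mul_apply, ← mul_sub_one, norm_mul, norm_fourier_apply, one_mul]
      exact norm_zpow_sub_one_le (norm_fourier_apply _ _) m
  simpa only [thetaComb, Complex.real_smul, one_mul] using hexpand

theorem abs_re_thetaComb_sub_le (h0 : 0 < q) (h1 : q < 1) (hr : r ≠ 0) (y : UnitAddCircle) :
    |(thetaComb q (2 * r) r y).re -
        (∑' m : ℤ, q ^ ((r + (2 * r : ℕ) * m) ^ 2)) * (fourier r y : ℂ).re| ≤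
      q ^ ((r : ℤ) ^ 2) * tailBound q (2 * r) * ‖(fourier (2 * r : ℕ) y : ℂ) - 1‖ ^ 2 := by
  have hn0 : 2 * r ≠ 0 := by lia
  have habs (m : ℤ) : |(m : ℝ) * (m + 1)| ≤ 2 * (m : ℝ) ^ 2 := by
    rw [mul_add_one]
    refine (abs_add_le _ _).trans ?_
    rw [abs_mul_self]
    linarith [abs_intCast_le_sq m]
  have hexpand := norm_tsum_zpow_sq_smul_sub_le (a := (fourier r y : ℂ).re)
    (f := fun m : ℤ => (fourier (r + (2 * r : ℕ) * m) y : ℂ).re) h0 h1 hn0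
    (fun m => abs_nonneg ((m : ℝ) * (m + 1))) habs
    (fun m hm => sq_add_two_mul_mul_abs_le_add_sq r (by exact_mod_cast abs_ne_zero.1 hm))
    (summable_zpow_add_natCast_mul_sq h0 h1 hn0 r)
    (by positivity : 0 ≤ ‖(fourier (2 * r : ℕ) y : ℂ) - 1‖ ^ 2 / 2) fun m => by
      have hfreq : (r + (2 * r : ℕ) * m : ℤ) = r * (2 * m + 1) := by
        push_cast
        ring
      have hdouble : (fourier (2 * r : ℕ) y : ℂ) = (fourier r y : ℂ) ^ 2 := by
        rw [mul_comm, Nat.cast_mul, fourier_mul_apply, Nat.cast_ofNat, zpow_ofNat]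
      rw [hfreq, fourier_mul_apply, hdouble]
      exact abs_re_zpow_sub_re_le (norm_fourier_apply _ _) m
  rw [re_thetaComb h0 h1 hn0]
  simp only [smul_eq_mul, Real.norm_eq_abs] at hexpand
  linarith

end Expansion

end Theta

section Rigidity

variable {q δ ε : ℝ} {n r : ℕ} {ι : Type*} [Fintype ι] {x : ι → UnitAddCircle} {z : UnitAddCircle}

theorem norm_sum_thetaComb_le (h0 : 0 < q) (h1 : q < 1) (hn : 2 ≤ n) (hr0 : r ≠ 0)
    (hr : 2 * r ≤ n) (hx : ∀ y, ∑ j, thetaKernel q (x j - y) ≤ Fintype.card ι * combMax q n)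
    (hδ : ∀ j, ‖(fourier n (x j - z) : ℂ) - 1‖ ≤ δ) :
    ‖∑ j, thetaComb q n r (x j - z)‖ ≤
      Fintype.card ι * (q ^ ((r : ℤ) ^ 2) * tailBound q n * (δ ^ 2 / 2)) := by
  have hndvd : ¬ (n : ℤ) ∣ r := fun h => by
    have := Nat.le_of_dvd (Nat.pos_of_ne_zero hr0) (Int.natCast_dvd_natCast.1 h)
    lia
  have htail := tailBound_nonneg h0.le n
  have hlower : Fintype.card ι * (combMax q n - q ^ ((r : ℤ) ^ 2) * tailBound q n * (δ ^ 2 / 2)) ≤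
      ∑ j, (thetaComb q n 0 (x j - z)).re := by
    rw [← nsmul_eq_mul, ← card_univ]
    refine card_nsmul_le_sum _ _ _ fun j _ => ?_
    have hexpand := (abs_le.1 (abs_re_thetaComb_zero_sub_combMax_le h0 h1 hn hr (x j - z))).1
    have : q ^ ((r : ℤ) ^ 2) * tailBound q n * (‖(fourier n (x j - z) : ℂ) - 1‖ ^ 2 / 2) ≤
        q ^ ((r : ℤ) ^ 2) * tailBound q n * (δ ^ 2 / 2) := by
      gcongr
      exact hδ j
    linarith
  have haverage := sum_re_thetaComb_add_norm_sum_le h0 h1 (by lia) hndvd hx z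
  linarith

theorem norm_sum_fourier_le_of_two_mul_lt (h0 : 0 < q) (h1 : q < 1) (hr0 : r ≠ 0)
    (hr : 2 * r < n) (hx : ∀ y, ∑ j, thetaKernel q (x j - y) ≤ Fintype.card ι * combMax q n)
    (hδ : ∀ j, ‖(fourier n (x j - z) : ℂ) - 1‖ ≤ δ) :
    ‖∑ j, (fourier r (x j) : ℂ)‖ ≤ Fintype.card ι * tailBound q n * (δ + δ ^ 2 / 2) := by
  have htail := tailBound_nonneg h0.le n
  have hq : 0 < q ^ ((r : ℤ) ^ 2) := zpow_pos h0 _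
  let M : ℝ := ∑' m : ℤ, q ^ ((r + n * m) ^ 2)
  have hM : q ^ ((r : ℤ) ^ 2) ≤ M := zpow_sq_le_tsum h0 h1 (by lia) r
  have hmain : ‖∑ j, (thetaComb q n r (x j - z) - M * fourier r (x j - z))‖ ≤
      Fintype.card ι * (q ^ ((r : ℤ) ^ 2) * tailBound q n * δ) := by
    rw [← nsmul_eq_mul, ← card_univ, ← sum_const]
    refine norm_sum_le_of_le _ fun j _ => (norm_thetaComb_sub_le h0 h1 hr _).trans ?_
    gcongr
    exact hδ j
  have hcomb := norm_sum_thetaComb_le h0 h1 (by lia) hr0 hr.le hx hδ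
  have hsum : M * ‖∑ j, (fourier r (x j) : ℂ)‖ = ‖∑ j, M * (fourier r (x j - z) : ℂ)‖ := by
    rw [← mul_sum, sum_fourier_sub, norm_mul, norm_mul, norm_fourier_apply, mul_one,
      Complex.norm_real, Real.norm_of_nonneg (hq.le.trans hM)]
  refine le_of_mul_le_mul_left ?_ hq
  calc q ^ ((r : ℤ) ^ 2) * ‖∑ j, (fourier r (x j) : ℂ)‖
      ≤ M * ‖∑ j, (fourier r (x j) : ℂ)‖ := by gcongr
    _ ≤ ‖∑ j, thetaComb q n r (x j - z)‖ +
          ‖∑ j, (thetaComb q n r (x j - z) - M * fourier r (x j - z))‖ := by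
        rw [hsum, sum_sub_distrib]
        exact norm_le_norm_add_norm_sub _ _
    _ ≤ q ^ ((r : ℤ) ^ 2) * (Fintype.card ι * tailBound q n * (δ + δ ^ 2 / 2)) := by linarith

/- For `n = 2r` the frequencies `r` and `-r` are congruent modulo `n`, so `thetaComb q n r` only
sees real parts. -/
theorem abs_re_sum_fourier_sub_le (h0 : 0 < q) (h1 : q < 1) (hr0 : r ≠ 0)
    (hx : ∀ y, ∑ j, thetaKernel q (x j - y) ≤ Fintype.card ι * combMax q (2 * r))
    (hδ : ∀ j, ‖(fourier (2 * r : ℕ) (x j - z) : ℂ) - 1‖ ≤ δ) :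
    |(∑ j, (fourier r (x j - z) : ℂ)).re| ≤
      Fintype.card ι * tailBound q (2 * r) * (3 / 2 * δ ^ 2) := by
  have htail := tailBound_nonneg h0.le (2 * r)
  have hq : 0 < q ^ ((r : ℤ) ^ 2) := zpow_pos h0 _
  let M : ℝ := ∑' m : ℤ, q ^ ((r + (2 * r : ℕ) * m) ^ 2)
  have hM : q ^ ((r : ℤ) ^ 2) ≤ M := zpow_sq_le_tsum h0 h1 (by lia) r
  have hmain : |∑ j, ((thetaComb q (2 * r) r (x j - z)).re - M * (fourier r (x j - z) : ℂ).re)| ≤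
      Fintype.card ι * (q ^ ((r : ℤ) ^ 2) * tailBound q (2 * r) * δ ^ 2) := by
    rw [← nsmul_eq_mul, ← card_univ, ← sum_const]
    refine (abs_sum_le_sum_abs _ _).trans (sum_le_sum fun j _ => ?_)
    refine (abs_re_thetaComb_sub_le h0 h1 hr0 _).trans ?_
    gcongr
    exact hδ j
  have hcomb := (Complex.abs_re_le_norm _).trans
    (norm_sum_thetaComb_le h0 h1 (by lia) hr0 le_rfl hx hδ)
  rw [Complex.re_sum] at hcomb ⊢
  refine le_of_mul_le_mul_left ?_ hq
  calc q ^ ((r : ℤ) ^ 2) * |∑ j, (fourier r (x j - z) : ℂ).re|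
      ≤ M * |∑ j, (fourier r (x j - z) : ℂ).re| := by gcongr
    _ ≤ |∑ j, (thetaComb q (2 * r) r (x j - z)).re| +
          |∑ j, ((thetaComb q (2 * r) r (x j - z)).re - M * (fourier r (x j - z) : ℂ).re)| := by
        rw [← abs_of_pos (hq.trans_le hM), ← abs_mul, mul_sum, sum_sub_distrib,
          abs_of_pos (hq.trans_le hM)]
        exact sub_le_iff_le_add'.1 ((abs_sub_abs_le_abs_sub _ _).trans_eq (abs_sub_comm _ _))
    _ ≤ _ := by linarith

theorem exists_fourier_eq_exp (hr : r ≠ 0) (β : ℝ) :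
    ∃ s : UnitAddCircle, (fourier (-r : ℤ) s : ℂ) = Complex.exp (β * Complex.I) := by
  refine ⟨((-β / (2 * Real.pi * r) : ℝ) : UnitAddCircle), ?_⟩
  rw [fourier_coe_apply]
  congr 1
  push_cast
  have : (r : ℂ) ≠ 0 := Nat.cast_ne_zero.2 hr
  field_simp

theorem exists_norm_mul_le_abs_re_mul_fourier (hr : r ≠ 0) (P : ℂ) (hδ0 : 0 ≤ δ) (hδ : δ ≤ 1) :
    ∃ s : UnitAddCircle, ‖(fourier (-(2 * r : ℕ) : ℤ) s : ℂ) - 1‖ ≤ δ ∧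
      ‖P‖ * (δ / 4) ≤ |(P * fourier (-r : ℤ) s).re| := by
  have hsin : δ / 4 ≤ Real.sin (δ / 2) := by
    have hpi : 2 / 4 ≤ 2 / Real.pi := by gcongr; exact Real.pi_le_four
    calc δ / 4 = 2 / 4 * (δ / 2) := by ring
      _ ≤ 2 / Real.pi * (δ / 2) := by gcongr
      _ ≤ Real.sin (δ / 2) :=
        Real.mul_le_sin (by positivity) (by linarith [Real.pi_gt_three])
  have hsin_cos : Real.sin (δ / 2) ≤ Real.cos (δ / 2) := by
    have := Real.sin_le (by positivity : 0 ≤ δ / 2)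
    nlinarith [Real.one_sub_sq_div_two_le_cos (x := δ / 2)]
  obtain ⟨β, hβ, hre⟩ := exists_norm_mul_sin_le_abs_re P (by linarith) hsin_cos
  obtain ⟨s, hs⟩ := exists_fourier_eq_exp hr β
  refine ⟨s, ?_, ?_⟩
  · have hdouble : (fourier (-(2 * r : ℕ) : ℤ) s : ℂ) =
        Complex.exp (Complex.I * (2 * β : ℝ)) := by
      rw [Nat.cast_mul, mul_comm, ← neg_mul, fourier_mul_apply, hs, ← Complex.exp_int_mul]
      congr 1
      push_cast
      ring
    rw [hdouble]
    refine (Real.norm_exp_I_mul_ofReal_sub_one_le).trans_eq ?_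
    rw [Real.norm_eq_abs, abs_mul, hβ, abs_of_nonneg (by positivity : 0 ≤ δ / 2), abs_two]
    ring
  · rw [hs]
    exact (mul_le_mul_of_nonneg_left hsin (norm_nonneg P)).trans hre

theorem norm_sum_fourier_sq_le (h0 : 0 < q) (h1 : q < 1) (hr0 : r ≠ 0) (hn : n = 2 * r)
    (hx : ∀ y, ∑ j, thetaKernel q (x j - y) ≤ Fintype.card ι * combMax q n)
    (hε : ‖∑ j, (fourier r (x j) : ℂ)‖ = ε) (hε1 : ε ≤ 1)
    (hδ : ∀ j, ‖(fourier n (x j - z) : ℂ) - 1‖ ≤ δ) :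
    ε * (ε / 4) ≤ Fintype.card ι * tailBound q n * (3 / 2 * (δ + ε) ^ 2) := by
  subst hn
  obtain ⟨s, hs, hre⟩ := exists_norm_mul_le_abs_re_mul_fourier hr0
    (∑ j, (fourier r (x j - z) : ℂ)) (hε ▸ norm_nonneg _) hε1
  rw [sum_fourier_sub, norm_mul, norm_fourier_apply, mul_one, ← sum_fourier_sub, hε,
    ← sum_fourier_sub univ r (fun j => x j - z) s] at hre
  simp only [sub_sub] at hre
  refine hre.trans (abs_re_sum_fourier_sub_le h0 h1 hr0 hx fun j => ?_)
  rw [← sub_sub, fourier_apply_sub]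
  calc ‖(fourier (2 * r : ℕ) (x j - z) : ℂ) * fourier (-(2 * r : ℕ) : ℤ) s - 1‖
      = ‖((fourier (2 * r : ℕ) (x j - z) : ℂ) - 1) * fourier (-(2 * r : ℕ) : ℤ) s +
          ((fourier (-(2 * r : ℕ) : ℤ) s : ℂ) - 1)‖ := by ring_nf
    _ ≤ δ + ε := by
        refine norm_add_le_of_le ?_ hs
        simpa only [norm_mul, norm_fourier_apply, mul_one] using hδ j

theorem norm_sum_fourier_eq_zero_of_norm_sub_one_le (h0 : 0 < q) (h1 : q < 1) (hr0 : r ≠ 0)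
    (hr : 2 * r ≤ Fintype.card ι)
    (hsmall : 100 * Fintype.card ι ^ 3 * tailBound q (Fintype.card ι) < 1)
    (hx : ∀ y, ∑ j, thetaKernel q (x j - y) ≤ Fintype.card ι * combMax q (Fintype.card ι))
    (hε : ‖∑ j, (fourier r (x j) : ℂ)‖ = ε) (hε1 : ε ≤ 1)
    (hδ : ∀ j, ‖(fourier (Fintype.card ι) (x j - z) : ℂ) - 1‖ ≤ 2 * Fintype.card ι * ε) :
    ε = 0 := by
  have hε0 : 0 ≤ ε := hε ▸ norm_nonneg _
  have hcard : (1 : ℝ) ≤ Fintype.card ι := by exact_mod_cast (by lia : 1 ≤ Fintype.card ι)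
  have htail := tailBound_nonneg h0.le (Fintype.card ι)
  by_contra hne
  have hlt_one : ε * (100 * Fintype.card ι ^ 3 * tailBound q (Fintype.card ι)) < ε :=
    mul_lt_of_lt_one_right (hε0.lt_of_ne' hne) hsmall
  rcases hr.lt_or_eq with hlt | heq
  · have hδ_le : 2 * Fintype.card ι * ε + (2 * Fintype.card ι * ε) ^ 2 / 2 ≤
        4 * Fintype.card ι ^ 2 * ε := by
      nlinarith [mul_le_mul_of_nonneg_right (le_self_pow₀ hcard two_ne_zero) hε0,
        mul_le_mul_of_nonneg_left (pow_le_of_le_one hε0 hε1 two_ne_zero)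
          (sq_nonneg (Fintype.card ι : ℝ))]
    have hle := norm_sum_fourier_le_of_two_mul_lt h0 h1 hr0 hlt hx hδ
    rw [hε] at hle
    have := hle.trans (mul_le_mul_of_nonneg_left hδ_le (by positivity))
    linarith
  · have hδ_le : 2 * Fintype.card ι * ε + ε ≤ 3 * Fintype.card ι * ε := by nlinarith
    have hle := norm_sum_fourier_sq_le h0 h1 hr0 heq.symm hx hε hε1 hδ
    have : Fintype.card ι * tailBound q (Fintype.card ι) *
        (3 / 2 * (2 * Fintype.card ι * ε + ε) ^ 2) ≤
        Fintype.card ι * tailBound q (Fintype.card ι) * (3 / 2 * (3 * Fintype.card ι * ε) ^ 2) := by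
      gcongr
    nlinarith

theorem norm_fourier_card_sub_sub_one_le (hε : ε ≤ 1)
    (hp : ∀ k : ℕ, 1 ≤ k → 2 * k ≤ Fintype.card ι → ‖∑ j, (fourier k (x j) : ℂ)‖ ≤ ε) (i j : ι) :
    ‖(fourier (Fintype.card ι) (x j - x i) : ℂ) - 1‖ ≤ 2 * (Fintype.card ι - 1 : ℕ) * ε := by
  have hpow := norm_pow_card_sub_pow_card_le (z := fun j => (fourier 1 (x j) : ℂ))
    (fun j => norm_fourier_apply _ _) hε (by simpa only [← fourier_natCast_apply] using hp) j i
  rw [← fourier_natCast_apply, ← fourier_natCast_apply] at hpow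
  have hfactor : (fourier (Fintype.card ι) (x j) : ℂ) - fourier (Fintype.card ι) (x i) =
      (fourier (Fintype.card ι) (x j - x i) - 1) * fourier (Fintype.card ι) (x i) := by
    rw [sub_one_mul, ← fourier_apply_add, sub_add_cancel]
  rwa [hfactor, norm_mul, norm_fourier_apply, mul_one] at hpow

theorem sum_fourier_eq_zero_of_sum_thetaKernel_le (h0 : 0 < q) (h1 : q < 1)
    (hsmall : 100 * Fintype.card ι ^ 3 * tailBound q (Fintype.card ι) < 1)
    (hx : ∀ y, ∑ j, thetaKernel q (x j - y) ≤ Fintype.card ι * combMax q (Fintype.card ι))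
    (hone : ∀ k : ℕ, 1 ≤ k → 2 * k ≤ Fintype.card ι → ‖∑ j, (fourier k (x j) : ℂ)‖ ≤ 1)
    (k : ℕ) (hk : 1 ≤ k) (hkn : 2 * k ≤ Fintype.card ι) : ∑ j, (fourier k (x j) : ℂ) = 0 := by
  obtain ⟨i⟩ : Nonempty ι := Fintype.card_pos_iff.1 (by lia)
  obtain ⟨r, hr, hmax⟩ := (Icc 1 (Fintype.card ι / 2)).exists_max_image
    (fun k : ℕ => ‖∑ j, (fourier k (x j) : ℂ)‖) ⟨k, mem_Icc.2 (by lia)⟩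
  rw [mem_Icc] at hr
  replace hmax (k : ℕ) (hk : 1 ≤ k) (hkn : 2 * k ≤ Fintype.card ι) :=
    hmax k (mem_Icc.2 (by lia))
  have hzero := norm_sum_fourier_eq_zero_of_norm_sub_one_le (z := x i) h0 h1 (by lia) (by lia)
    hsmall hx rfl (hone r hr.1 (by lia)) fun j => by
      refine (norm_fourier_card_sub_sub_one_le (hone r hr.1 (by lia)) hmax i j).trans ?_
      gcongr
      exact Nat.sub_le _ _
  exact norm_le_zero_iff.1 ((hmax k hk hkn).trans_eq hzero)

end Rigidity

section Equispaced

variable {n : ℕ} {x : Fin n → UnitAddCircle}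

theorem exists_eq_div_of_fourier_eq_one (hn : n ≠ 0) {y : UnitAddCircle}
    (hy : (fourier n y : ℂ) = 1) : ∃ l : Fin n, y = (((l : ℝ) / n : ℝ) : UnitAddCircle) := by
  rw [fourier_apply, Circle.coe_eq_one, ← toCircle_zero (T := 1)] at hy
  have htorsion := injective_toCircle one_ne_zero hy
  rw [natCast_zsmul, AddCircle.nsmul_eq_zero_iff (Nat.pos_of_ne_zero hn)] at htorsion
  obtain ⟨l, hl, rfl⟩ := htorsion
  exact ⟨⟨l, hl⟩, by rw [mul_one]⟩

theorem equispaced_of_injective (hn : n ≠ 0) (hx : Function.Injective x) (z : UnitAddCircle)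
    (hz : ∀ j, (fourier n (x j - z) : ℂ) = 1) : Equispaced x := by
  choose l hl using fun j => exists_eq_div_of_fourier_eq_one hn (hz j)
  have hl_inj : Function.Injective l := fun i j hij =>
    hx (sub_left_injective ((hl i).trans (hij ▸ (hl j).symm)))
  let σ : Equiv.Perm (Fin n) := Equiv.ofBijective l (Finite.injective_iff_bijective.1 hl_inj)
  refine ⟨z, σ.symm, fun k => ?_⟩
  have hσ : l (σ.symm k) = k := σ.apply_symm_apply k
  rw [← sub_eq_iff_eq_add', hl, hσ]

theorem equispaced_of_forall_sum_fourier_eq_zero (hn : n ≠ 0)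
    (hp : ∀ k : ℕ, 1 ≤ k → 2 * k ≤ n → ∑ j, (fourier k (x j) : ℂ) = 0) : Equispaced x := by
  have hinj : Function.Injective fun j => (fourier 1 (x j) : ℂ) :=
    injective_of_sum_pow_eq_zero (fun j => norm_fourier_apply _ _)
      (by simpa only [← fourier_natCast_apply, Fintype.card_fin] using hp)
  let i : Fin n := ⟨0, Nat.pos_of_ne_zero hn⟩
  refine equispaced_of_injective hn (hinj.of_comp (f := fun y => (fourier 1 y : ℂ))) (x i)
    fun j => ?_
  have hle := norm_fourier_card_sub_sub_one_le (x := x) zero_le_one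
    (by simpa only [norm_le_zero_iff, Fintype.card_fin] using hp) i j
  rwa [mul_zero, norm_le_zero_iff, sub_eq_zero, Fintype.card_fin] at hle

end Equispaced

section Kernel

variable {q : ℝ} {ι : Type*} [Fintype ι] {x : ι → UnitAddCircle}

theorem continuous_thetaKernel (h0 : 0 < q) (h1 : q < 1) : Continuous (thetaKernel q) := by
  refine continuous_tsum (fun k => by fun_prop) (summable_zpow_sq h0 h1) fun k y => ?_
  rw [norm_mul, Real.norm_of_nonneg (zpow_nonneg h0.le _)]
  exact mul_le_of_le_one_right (zpow_nonneg h0.le _)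
    ((Complex.abs_re_le_norm _).trans_eq (norm_fourier_apply k y))

theorem integral_mul_thetaKernel (h0 : 0 < q) (h1 : q < 1) {f : UnitAddCircle → ℂ}
    (hf : Integrable f haarAddCircle) (x : UnitAddCircle) :
    ∫ y, f y * thetaKernel q (x - y) ∂haarAddCircle =
      ∑' k : ℤ, ((q ^ (k ^ 2) : ℝ) : ℂ) * fourierCoeff f k * fourier k x := by
  have hnorm (k : ℤ) (y : UnitAddCircle) :
      ‖((q ^ (k ^ 2) : ℝ) : ℂ) * fourier k (x - y)‖ = q ^ (k ^ 2) := by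
    rw [norm_mul, norm_fourier_apply, mul_one, Complex.norm_real,
      Real.norm_of_nonneg (zpow_nonneg h0.le _)]
  have hint (k : ℤ) : Integrable
      (fun y => f y * (((q ^ (k ^ 2) : ℝ) : ℂ) * fourier k (x - y))) haarAddCircle :=
    hf.mul_bdd (c := q ^ (k ^ 2)) (by fun_prop) (.of_forall fun y => (hnorm k y).le)
  have hsum := hasSum_integral_of_summable_integral_norm hint (by
    simp only [norm_mul (f _), hnorm, integral_mul_const]
    exact (summable_zpow_sq h0 h1).mul_left _)
  simp only [ofReal_thetaKernel h0 h1, ← tsum_mul_left]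
  rw [← hsum.tsum_eq]
  refine tsum_congr fun k => ?_
  rw [fourierCoeff, mul_assoc, ← integral_mul_const, ← integral_const_mul]
  refine integral_congr_ae (.of_forall fun y => ?_)
  simp only [fourier_apply_sub, smul_eq_mul]
  ring

theorem integral_fourier_mul_thetaKernel (h0 : 0 < q) (h1 : q < 1) (k : ℤ) (x : UnitAddCircle) :
    ∫ y, (fourier k y : ℂ) * thetaKernel q (x - y) ∂haarAddCircle =
      ((q ^ (k ^ 2) : ℝ) : ℂ) * fourier k x := by
  rw [integral_mul_thetaKernel h0 h1 ((map_continuous (fourier k)).integrable_of_hasCompactSupport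
      (.of_compactSpace _)), fourierCoeff_fourier, tsum_eq_single k fun m hm => by simp [hm]]
  rw [Pi.single_eq_same, mul_one]

theorem integral_fourier_mul_sum_thetaKernel (h0 : 0 < q) (h1 : q < 1) (k : ℤ) :
    ∫ y, (fourier k y : ℂ) * (∑ j, thetaKernel q (x j - y) : ℝ) ∂haarAddCircle =
      ((q ^ (k ^ 2) : ℝ) : ℂ) * ∑ j, fourier k (x j) := by
  have hK := continuous_thetaKernel h0 h1
  simp only [Complex.ofReal_sum, mul_sum]
  rw [integral_finsetSum _ fun j _ =>
    (by fun_prop : Continuous _).integrable_of_hasCompactSupport (.of_compactSpace _)]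
  exact sum_congr rfl fun j _ => integral_fourier_mul_thetaKernel h0 h1 k (x j)

theorem integral_sum_thetaKernel (h0 : 0 < q) (h1 : q < 1) :
    ∫ y, ∑ j, thetaKernel q (x j - y) ∂haarAddCircle = Fintype.card ι := by
  have := integral_fourier_mul_sum_thetaKernel (x := x) h0 h1 0
  simp only [fourier_zero, one_mul, integral_complex_ofReal, zero_pow two_ne_zero, zpow_zero,
    sum_const, card_univ, nsmul_one, Complex.ofReal_one] at this
  exact_mod_cast this

theorem card_add_zpow_sq_mul_norm_sum_fourier_le (h0 : 0 < q) (h1 : q < 1) {B : ℝ}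
    (hB : ∀ y, ∑ j, thetaKernel q (x j - y) ≤ B) {k : ℤ} (hk : k ≠ 0) :
    Fintype.card ι + q ^ (k ^ 2) * ‖∑ j, (fourier k (x j) : ℂ)‖ ≤ B := by
  have hK := continuous_thetaKernel h0 h1
  have hmean : ∫ y, (fourier k y : ℂ) ∂(haarAddCircle (T := 1)) = 0 := by
    have := congrFun (fourierCoeff_fourier (T := 1) k) 0
    rw [Pi.single_eq_of_ne hk.symm, fourierCoeff] at this
    simpa using this
  have hS : Continuous fun y => ∑ j, thetaKernel q (x j - y) := by fun_prop
  have hle := integral_add_norm_integral_mul_le (μ := haarAddCircle)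
    (hS.integrable_of_hasCompactSupport (.of_compactSpace _))
    ((map_continuous (fourier k)).integrable_of_hasCompactSupport (.of_compactSpace _))
    (.of_forall hB) (.of_forall fun y => (norm_fourier_apply k y).le) hmean
  rwa [integral_sum_thetaKernel h0 h1, integral_fourier_mul_sum_thetaKernel h0 h1, norm_mul,
    Complex.norm_real, Real.norm_of_nonneg (zpow_nonneg h0.le _), probReal_univ, one_mul] at hle

theorem one_le_combMax (h0 : 0 < q) (h1 : q < 1) {n : ℕ} (hn : n ≠ 0) : 1 ≤ combMax q n := by
  simpa [combMax] using zpow_sq_le_tsum h0 h1 hn 0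

theorem combMax_sub_one_le (h0 : 0 < q) (h1 : q < 1) {n r : ℕ} (hn : 2 ≤ n) (hr : 2 * r ≤ n) :
    combMax q n - 1 ≤ q ^ ((r : ℤ) ^ 2) * tailBound q n := by
  have hsum := summable_zpow_add_natCast_mul_sq h0 h1 (by lia : n ≠ 0) 0
  have hle := tsum_mul_zpow_sq_le (n := n) (r := r) (B := 1)
    (b := fun m : ℤ => if m = 0 then 0 else 1) (g := fun m => 0 + n * m) h0 h1 (by lia)
    (fun m => by positivity) (fun m => by
      split_ifs with hm
      · positivity
      · rw [one_mul, one_le_sq_iff_one_le_abs]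
        exact_mod_cast Int.one_le_abs hm)
    fun m hm => sq_add_mul_abs_le_zero_add_sq hn hr (by simpa using hm)
  rw [combMax]
  simp only [zero_add] at hsum hle ⊢
  rw [hsum.tsum_eq_add_tsum_ite 0]
  simpa using hle

theorem equispaced_of_sum_thetaKernel_le (h0 : 0 < q) (h1 : q < 1) {n : ℕ} (hn : 2 ≤ n)
    (hsmall : 100 * n ^ 3 * tailBound q n < 1) {x : Fin n → UnitAddCircle}
    (hx : ∀ y, ∑ j, thetaKernel q (x j - y) ≤ n * combMax q n) : Equispaced x := by
  have htail := tailBound_nonneg h0.le n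
  have hn1 : (1 : ℝ) ≤ n := by exact_mod_cast (by lia : 1 ≤ n)
  have hone (k : ℕ) (hk : 1 ≤ k) (hkn : 2 * k ≤ n) : ‖∑ j, (fourier k (x j) : ℂ)‖ ≤ 1 := by
    have hq : 0 < q ^ ((k : ℤ) ^ 2) := zpow_pos h0 _
    have hcoeff := card_add_zpow_sq_mul_norm_sum_fourier_le h0 h1 hx (k := k) (by lia)
    rw [Fintype.card_fin] at hcoeff
    have hcomb := mul_le_mul_of_nonneg_left (combMax_sub_one_le h0 h1 hn hkn) (Nat.cast_nonneg n)
    have htail_le : n * tailBound q n ≤ 1 := by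
      have := mul_le_mul_of_nonneg_right (le_self_pow₀ hn1 three_ne_zero) htail
      nlinarith
    refine le_of_mul_le_mul_left ?_ hq
    have := mul_le_mul_of_nonneg_left htail_le hq.le
    linarith
  refine equispaced_of_forall_sum_fourier_eq_zero (by lia) fun k hk hkn => ?_
  exact sum_fourier_eq_zero_of_sum_thetaKernel_le h0 h1
    (by simpa only [Fintype.card_fin] using hsmall) (by simpa only [Fintype.card_fin] using hx)
    (by simpa only [Fintype.card_fin] using hone) k hk (by rwa [Fintype.card_fin])

end Kernel

section WorstCase

/-- The nome `q` for which `thetaKernel q` is the kernel of `e^{tΔ}`. -/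
def heatNome (t : ℝ) : ℝ := Real.exp (-(4 * Real.pi ^ 2 * t))

theorem heatNome_pos (t : ℝ) : 0 < heatNome t := Real.exp_pos _

theorem heatNome_lt_one {t : ℝ} (ht : 0 < t) : heatNome t < 1 :=
  Real.exp_lt_one_iff.2 (neg_neg_of_pos (by positivity))

theorem heatNome_zpow_sq (t : ℝ) (k : ℤ) :
    heatNome t ^ (k ^ 2) = Real.exp (-(4 * Real.pi ^ 2 * (k : ℝ) ^ 2 * t)) := by
  rw [heatNome, ← Real.rpow_intCast, ← Real.exp_mul]
  push_cast
  ring_nf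

theorem heatFlow_eq_integral {t : ℝ} (ht : 0 < t) {f : UnitAddCircle → ℂ}
    (hf : Integrable f haarAddCircle) (x : UnitAddCircle) :
    heatFlow t f x = ∫ y, f y * thetaKernel (heatNome t) (x - y) ∂haarAddCircle := by
  simp only [integral_mul_thetaKernel (heatNome_pos t) (heatNome_lt_one ht) hf, heatNome_zpow_sq,
    heatFlow]

/-- The density of the empirical measure of the points `x j` smoothed by `thetaKernel q`, minus the
uniform density. -/
def discrepancy {n : ℕ} (q : ℝ) (x : Fin n → UnitAddCircle) (y : UnitAddCircle) : ℝ :=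
  (∑ j, thetaKernel q (x j - y)) / n - 1

variable {t : ℝ} {n : ℕ} {x : Fin n → UnitAddCircle}

theorem continuous_discrepancy {q : ℝ} (h0 : 0 < q) (h1 : q < 1) (x : Fin n → UnitAddCircle) :
    Continuous (discrepancy q x) := by
  have := continuous_thetaKernel h0 h1
  unfold discrepancy
  fun_prop

theorem integrable_mul_of_continuous {f g : UnitAddCircle → ℂ} (hf : Integrable f haarAddCircle)
    (hg : Continuous g) : Integrable (fun y => f y * g y) haarAddCircle :=
  have ⟨_, hC⟩ := isCompact_univ.exists_bound_of_continuousOn hg.continuousOn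
  hf.mul_bdd hg.aestronglyMeasurable (.of_forall fun y => hC y (Set.mem_univ y))

theorem samplingError_eq_norm_integral (ht : 0 < t) (x : Fin n → UnitAddCircle)
    {f : UnitAddCircle → ℂ} (hf : Integrable f haarAddCircle) :
    samplingError t x f = ‖∫ y, f y * discrepancy (heatNome t) x y ∂haarAddCircle‖ := by
  have hK := continuous_thetaKernel (heatNome_pos t) (heatNome_lt_one ht)
  have hint (j : Fin n) :
      Integrable (fun y => f y * thetaKernel (heatNome t) (x j - y)) haarAddCircle :=
    integrable_mul_of_continuous hf (by fun_prop)
  have hsplit (y : UnitAddCircle) : f y * discrepancy (heatNome t) x y =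
      (1 / (n : ℂ)) * (∑ j, f y * thetaKernel (heatNome t) (x j - y)) - f y := by
    rw [discrepancy, ← mul_sum]
    push_cast
    ring
  simp only [hsplit]
  rw [integral_sub ((integrable_finsetSum _ fun j _ => hint j).const_mul _) hf,
    integral_const_mul, integral_finsetSum _ fun j _ => hint j, samplingError]
  simp only [heatFlow_eq_integral ht hf]

theorem worstCaseError_le (ht : 0 < t) {C : ℝ}
    (hC : ∀ y, |discrepancy (heatNome t) x y| ≤ C) : worstCaseError t x ≤ ENNReal.ofReal C := by
  refine iSup₂_le fun f hf => ENNReal.ofReal_le_ofReal ?_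
  rw [div_le_iff₀ (norm_pos_iff.2 hf),
    samplingError_eq_norm_integral ht x (L1.integrable_coeFn f), L1.norm_eq_integral_norm,
    ← integral_const_mul]
  refine norm_integral_le_of_norm_le ((L1.integrable_coeFn f).norm.const_mul C)
    (.of_forall fun y => ?_)
  rw [norm_mul, Complex.norm_real, mul_comm]
  exact mul_le_mul_of_nonneg_right (hC y) (norm_nonneg _)

theorem samplingError_le_mul_norm (ht : 0 < t) {C : ℝ} (hC0 : 0 ≤ C)
    (hC : worstCaseError t x ≤ ENNReal.ofReal C) (f : Lp ℂ 1 (haarAddCircle (T := (1 : ℝ)))) :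
    samplingError t x f ≤ C * ‖f‖ := by
  rcases eq_or_ne f 0 with rfl | hf
  · rw [samplingError_eq_norm_integral ht x (L1.integrable_coeFn 0)]
    simp
  · rw [← div_le_iff₀ (norm_pos_iff.2 hf), ← ENNReal.ofReal_le_ofReal_iff hC0]
    exact (le_iSup₂ (f := fun (f : Lp ℂ 1 (haarAddCircle (T := (1 : ℝ)))) (_ : f ≠ 0) =>
      ENNReal.ofReal (samplingError t x f / ‖f‖)) f hf).trans hC

theorem le_of_forall_setIntegral_le {X : Type*} [TopologicalSpace X] [MeasurableSpace X]
    [BorelSpace X] {μ : Measure X} [IsFiniteMeasure μ] [μ.IsOpenPosMeasure] {g : X → ℝ} {C : ℝ}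
    (hg : Continuous g) (hgi : Integrable g μ)
    (h : ∀ s, MeasurableSet s → ∫ u in s, g u ∂μ ≤ C * μ.real s) (u : X) : g u ≤ C := by
  have hae : g ≤ᵐ[μ] fun _ => C :=
    ae_le_of_forall_setIntegral_le hgi (integrable_const C) fun s hs _ => by
      rw [setIntegral_const, smul_eq_mul, mul_comm]
      exact h s hs
  have hmin : (fun u => min (g u) C) = g :=
    ((hg.min continuous_const).ae_eq_iff_eq μ hg).1 (hae.mono fun u hu => min_eq_left hu)
  exact min_eq_left_iff.1 (congrFun hmin u)

theorem discrepancy_le (ht : 0 < t) {C : ℝ} (hC0 : 0 ≤ C)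
    (hC : worstCaseError t x ≤ ENNReal.ofReal C) (y : UnitAddCircle) :
    discrepancy (heatNome t) x y ≤ C := by
  have hcont := continuous_discrepancy (heatNome_pos t) (heatNome_lt_one ht) x
  refine le_of_forall_setIntegral_le hcont
    (hcont.integrable_of_hasCompactSupport (μ := haarAddCircle) (.of_compactSpace _))
    (fun s hs => ?_) y
  let f : Lp ℂ 1 (haarAddCircle (T := (1 : ℝ))) :=
    indicatorConstLp 1 hs (measure_ne_top _ s) (1 : ℂ)
  have hnorm : ‖f‖ = haarAddCircle.real s := by
    simp [f, norm_indicatorConstLp]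
  have hpair : ∫ u, f u * discrepancy (heatNome t) x u ∂haarAddCircle =
      (∫ u in s, discrepancy (heatNome t) x u ∂haarAddCircle : ℝ) := by
    have hf : f =ᵐ[haarAddCircle] s.indicator fun _ => 1 := indicatorConstLp_coeFn
    rw [← integral_complex_ofReal, ← integral_indicator hs]
    refine integral_congr_ae (hf.mono fun u hu => ?_)
    by_cases hus : u ∈ s <;> simp [hu, hus]
  have hle := samplingError_le_mul_norm ht hC0 hC f
  rw [samplingError_eq_norm_integral ht x (L1.integrable_coeFn f), hpair, Complex.norm_real,
    hnorm] at hle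
  exact (le_abs_self _).trans hle

theorem discrepancy_of_equispaced {q : ℝ} (h0 : 0 < q) (h1 : q < 1) (hn : n ≠ 0)
    (hx : Equispaced x) :
    ∃ z, ∀ y, discrepancy q x y = (thetaComb q n 0 (z - y)).re - 1 := by
  obtain ⟨z, σ, hσ⟩ := hx
  refine ⟨z, fun y => ?_⟩
  have hsum : ∑ j, thetaKernel q (x j - y) = n * (thetaComb q n 0 (z - y)).re := by
    rw [← sum_thetaKernel_add_div h0 h1 hn, sum_range, ← Equiv.sum_comp σ]
    refine sum_congr rfl fun k _ => ?_
    rw [hσ, add_sub_right_comm]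
  rw [discrepancy, hsum, mul_div_cancel_left₀ _ (Nat.cast_ne_zero.2 hn)]

theorem abs_re_thetaComb_zero_sub_one_le {q : ℝ} (h0 : 0 < q) (h1 : q < 1) (hn : n ≠ 0)
    (y : UnitAddCircle) : |(thetaComb q n 0 y).re - 1| ≤ combMax q n - 1 := by
  have hsum := summable_zpow_add_natCast_mul_sq h0 h1 hn 0
  have hcos (m : ℤ) := abs_le.1
    ((Complex.abs_re_le_norm _).trans_eq (norm_fourier_apply (0 + n * m) y))
  have hpos (m : ℤ) : 0 < q ^ ((0 + n * m : ℤ) ^ 2) := zpow_pos h0 _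
  have hsum_cos : Summable fun m : ℤ =>
      q ^ ((0 + n * m : ℤ) ^ 2) * (fourier (0 + n * m) y : ℂ).re :=
    .of_norm_bounded hsum fun m => by
      rw [norm_mul, Real.norm_of_nonneg (hpos m).le]
      exact mul_le_of_le_one_right (hpos m).le (abs_le.2 (hcos m))
  have hmax : combMax q n = ∑' m : ℤ, q ^ ((0 + n * m : ℤ) ^ 2) := by simp only [zero_add, combMax]
  rw [abs_le, re_thetaComb h0 h1 hn, hmax]
  constructor
  · have hle := (hsum.add hsum_cos).le_tsum 0 fun m _ => by
      nlinarith [hpos m, hcos m]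
    rw [hsum.tsum_add hsum_cos] at hle
    simp only [mul_zero, add_zero, ne_eq, OfNat.ofNat_ne_zero, not_false_eq_true, zero_pow,
      zpow_zero, fourier_zero, Complex.one_re, mul_one] at hle
    linarith
  · have hle := hsum_cos.tsum_le_tsum (fun m => mul_le_of_le_one_right (hpos m).le (hcos m).2) hsum
    linarith

theorem re_thetaComb_zero_zero {q : ℝ} (h0 : 0 < q) (h1 : q < 1) (hn : n ≠ 0) :
    (thetaComb q n 0 0).re = combMax q n := by
  simp [re_thetaComb h0 h1 hn, combMax]

theorem worstCaseError_of_equispaced (ht : 0 < t) (hn : n ≠ 0) (hx : Equispaced x) :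
    worstCaseError t x = ENNReal.ofReal (combMax (heatNome t) n - 1) := by
  have h0 := heatNome_pos t
  have h1 := heatNome_lt_one ht
  obtain ⟨z, hz⟩ := discrepancy_of_equispaced h0 h1 hn hx
  have hle : worstCaseError t x ≤ ENNReal.ofReal (combMax (heatNome t) n - 1) :=
    worstCaseError_le ht fun y => by
      rw [hz]
      exact abs_re_thetaComb_zero_sub_one_le h0 h1 hn _
  refine le_antisymm hle ?_
  have hge := discrepancy_le ht ENNReal.toReal_nonneg
    (ENNReal.ofReal_toReal (ne_top_of_le_ne_top ENNReal.ofReal_ne_top hle)).ge z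
  rw [hz, sub_self, re_thetaComb_zero_zero h0 h1 hn] at hge
  exact ENNReal.ofReal_le_of_le_toReal hge

theorem equispaced_of_worstCaseError_le (ht : 0 < t) (hn : 2 ≤ n)
    (hsmall : 100 * n ^ 3 * tailBound (heatNome t) n < 1)
    (hx : worstCaseError t x ≤ ENNReal.ofReal (combMax (heatNome t) n - 1)) : Equispaced x := by
  have h0 := heatNome_pos t
  have h1 := heatNome_lt_one ht
  refine equispaced_of_sum_thetaKernel_le h0 h1 hn hsmall fun y => ?_
  have hle := discrepancy_le ht (sub_nonneg.2 (one_le_combMax h0 h1 (by lia))) hx y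
  rwa [discrepancy, sub_le_sub_iff_right, div_le_iff₀' (by positivity)] at hle

theorem eventually_tailBound_lt {q : ℝ} (h0 : 0 < q) (h1 : q < 1) :
    ∀ᶠ n : ℕ in Filter.atTop, 100 * n ^ 3 * tailBound q n < 1 := by
  have hlim := (tendsto_pow_const_mul_const_pow_of_lt_one 3 h0.le h1).const_mul
    (100 * (q⁻¹ * ∑' m : ℤ, (m : ℝ) ^ 2 * q ^ m.natAbs))
  rw [mul_zero] at hlim
  filter_upwards [hlim.eventually_lt_const zero_lt_one] with n hn
  rw [tailBound]
  linarith

end WorstCase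

end HeatSampling

end

theorem mainTheorem3 :
    ∀ t : ℝ, 0 < t → ∃ N : ℕ, ∀ n : ℕ, N ≤ n → ∀ x : Fin n → UnitAddCircle,
      (∀ y : Fin n → UnitAddCircle,
        HeatSampling.worstCaseError t x ≤ HeatSampling.worstCaseError t y) ↔
      HeatSampling.Equispaced x := by
  intro t ht
  have hsmall_eventually := HeatSampling.eventually_tailBound_lt (HeatSampling.heatNome_pos t)
    (HeatSampling.heatNome_lt_one ht)
  obtain ⟨N, hN⟩ :=
    Filter.eventually_atTop.1 ((Filter.eventually_ge_atTop 2).and hsmall_eventually)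
  refine ⟨N, fun n hn x => ?_⟩
  obtain ⟨hn2, hsmall⟩ := hN n hn
  have herror (y : Fin n → UnitAddCircle) (hy : HeatSampling.Equispaced y) :
      HeatSampling.worstCaseError t y =
        ENNReal.ofReal (HeatSampling.combMax (HeatSampling.heatNome t) n - 1) :=
    HeatSampling.worstCaseError_of_equispaced ht (by lia) hy
  constructor
  · intro hmin
    have hequi : HeatSampling.Equispaced fun k : Fin n => (((k : ℝ) / n : ℝ) : UnitAddCircle) :=
      ⟨0, Equiv.refl _, fun k => (zero_add _).symm⟩
    exact HeatSampling.equispaced_of_worstCaseError_le ht hn2 hsmall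
      ((hmin _).trans_eq (herror _ hequi))
  · intro hx y
    by_contra! hlt
    have hy := HeatSampling.equispaced_of_worstCaseError_le ht hn2 hsmall
      (hlt.le.trans_eq (herror x hx))
    exact hlt.ne ((herror y hy).trans (herror x hx).symm)
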